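/- Let $p$ be a prime and $q=p^f$ with $f\ge 1$, and $f\ge 2$ if $p=2$. Let $\Gamma=(\mathcal V,\mathcal E)$ be a finite digraph without loops, $\mathcal E\subseteq \mathcal V\times\mathcal V\smallsetminus\{(x,x)\mid x\in\mathcal V\}$; an edge $(x,y)\in\mathcal E$ is called directed if $(y,x)\notin\mathcal E$, and undirected otherwise. Let $G$ be the oriented right-angled Artin pro-$p$ group associated to $\Gamma$ and $q$, i.e. the quotient of the free pro-$p$ group on $\mathcal V$ by the closed normal subgroup generated by the elements $[x,y]$ for every undirected edge $(x,y)$, and $[y,x]x^{-q}$ for every directed edge $(x,y)$, where $[x,y]=xyx^{-1}y^{-1}$. For $x\in\mathcal V$ let $x^*\in \mathrm H^1(G,\mathbb F_p)=\mathrm{Hom}_{\mathrm{cts}}(G,\mathbb F_p)$ be the continuous homomorphism with $x^*(x)=1$ and $x^*(y)=0$ for all $y\in\mathcal V$, $y\ne x$. Suppose that $\Gamma$ has three distinct vertices $u,v,w$ such that $(u,w)$ is a directed edge, $(u,v)\notin\mathcal E$ and $(v,u)\notin\mathcal E$, and one of the following holds: either $(v,w)$ is a directed edge; or $(w,v)\in\mathcal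 E$ (and possibly also $(v,w)\in\mathcal E$). Put $\alpha=u^*+v^*$ and $\beta=u^*$. Then the $q$-fold Massey product $$\langle\alpha,\underbrace{\beta,\ldots,\beta}_{q-2},\alpha\rangle\subseteq \mathrm H^2(G,\mathbb F_p)$$ is essential, i.e. it is non-empty and does not contain $0$. Here $\mathrm H^2(G,\mathbb F_p)$ is defined through continuous cochains, and for $\alpha_1,\ldots,\alpha_n\in\mathrm H^1(G,\mathbb F_p)$, $n\ge 2$, the Massey product $\langle\alpha_1,\ldots,\alpha_n\rangle$ is the set of the classes of the $2$-cocycles $\sum_{l=2}^{n}c_{1,l}\smallsmile c_{l,n+1}$, where $(c_{i,j})_{1\le i<j\le n+1,\ (i,j)\neq(1,n+1)}$ runs through the families of continuous maps $c_{i,j}\colon G\to\mathbb F_p$ with $c_{i,i+1}=\alpha_i$ for all $i$ and $\mathrm d c_{i,j}=\sum_{i<l<j}c_{i,l}\smallsmile c_{l,j}$ for all $(i,j)\ne(1,n+1)$; here $(a\smallsmile b)(g,h)=a(g)b(h)$ and $(\mathrm d c)(g,h)=c(h)-c(gh)+c(g)$. -/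

import Mathlib

noncomputable section

/-! ## Pro-`p` completions -/

/-- A normal subgroup of `H` whose index is a (finite) power of `p`. -/
structure PIndexSubgroup (p : ℕ) (H : Type*) [Group H] where
  /-- The underlying subgroup. -/
  toSubgroup : Subgroup H
  normal : toSubgroup.Normal
  index_eq : ∃ k : ℕ, toSubgroup.index = p ^ k

/-- The finite `p`-group `H ⧸ N`, regarded as a discrete topological group. -/
def PQuotient {p : ℕ} {H : Type*} [Group H] (N : PIndexSubgroup p H) : Type _ :=
  H ⧸ N.toSubgroup

namespace PQuotient

variable {p : ℕ} {H : Type*} [Group H]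

instance (N : PIndexSubgroup p H) : Group (PQuotient N) :=
  haveI := N.normal
  inferInstanceAs (Group (H ⧸ N.toSubgroup))

instance (N : PIndexSubgroup p H) : TopologicalSpace (PQuotient N) := ⊥

instance (N : PIndexSubgroup p H) : DiscreteTopology (PQuotient N) := ⟨rfl⟩

/-- The projection `H → H ⧸ N`. -/
def proj (N : PIndexSubgroup p H) : H →* PQuotient N :=
  haveI := N.normal
  QuotientGroup.mk' N.toSubgroup

/-- The canonical map `H ⧸ N → H ⧸ M` for `N ≤ M`. -/
def trans (N M : PIndexSubgroup p H) (h : N.toSubgroup ≤ M.toSubgroup) :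
    PQuotient N →* PQuotient M :=
  haveI := N.normal
  haveI := M.normal
  QuotientGroup.map N.toSubgroup M.toSubgroup (MonoidHom.id H) h

end PQuotient

/-- The pro-`p` completion of the abstract group `H`: the inverse limit of its finite quotients
`H ⧸ N` of `p`-power order, inside the product of all of these (with the product topology). -/
def proPCompletion (p : ℕ) (H : Type*) [Group H] :
    Subgroup (∀ N : PIndexSubgroup p H, PQuotient N) where
  carrier := {x | ∀ (N M : PIndexSubgroup p H) (h : N.toSubgroup ≤ M.toSubgroup),
    PQuotient.trans N M h (x N) = x M}
  one_mem' := fun N M h => map_one _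
  mul_mem' := fun hx hy N M h => by
    rw [Pi.mul_apply, Pi.mul_apply, map_mul, hx N M h, hy N M h]
  inv_mem' := fun hx N M h => by
    rw [Pi.inv_apply, Pi.inv_apply, map_inv, hx N M h]

/-- The canonical homomorphism of `H` into its pro-`p` completion. -/
def toProPCompletion (p : ℕ) (H : Type*) [Group H] : H →* proPCompletion p H where
  toFun x := ⟨fun N => PQuotient.proj N x, fun _ _ _ => rfl⟩
  map_one' := Subtype.ext (funext fun N => map_one (PQuotient.proj N))
  map_mul' x y := Subtype.ext (funext fun N => map_mul (PQuotient.proj N) x y)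

section Lift

variable {p : ℕ} [Fact p.Prime] {H : Type*} [Group H] {P : Type*} [Group P] [Finite P]

/-- The kernel of a homomorphism into a finite `p`-group, as a normal subgroup of `p`-power
index. -/
def kerPIndex (hP : IsPGroup p P) (φ : H →* P) : PIndexSubgroup p H where
  toSubgroup := φ.ker
  normal := φ.normal_ker
  index_eq := by
    rw [Subgroup.index_ker]
    exact IsPGroup.iff_card.mp (hP.to_subgroup φ.range)

/-- A homomorphism from `H` to a finite `p`-group extends to the pro-`p` completion of `H`. -/
def proPLift (hP : IsPGroup p P) (φ : H →* P) : proPCompletion p H →* P where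
  toFun x := QuotientGroup.kerLift φ (x.1 (kerPIndex hP φ))
  map_one' := map_one (QuotientGroup.kerLift φ)
  map_mul' _ _ := map_mul (QuotientGroup.kerLift φ) _ _

theorem proPLift_apply (hP : IsPGroup p P) (φ : H →* P) (x : H) :
    proPLift hP φ (toProPCompletion p H x) = φ x := rfl

theorem continuous_proPLift [TopologicalSpace P] (hP : IsPGroup p P) (φ : H →* P) :
    Continuous (proPLift hP φ) := by
  have h1 : Continuous fun y : PQuotient (kerPIndex hP φ) =>
      (QuotientGroup.kerLift φ : H ⧸ φ.ker → P) y := continuous_of_discreteTopology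
  exact h1.comp ((continuous_apply (kerPIndex hP φ)).comp continuous_subtype_val)

end Lift

/-! ## Oriented pro-`p` RAAGs -/

/-- The free pro-`p` group on the finite set `V`. -/
abbrev FreeProP (p : ℕ) (V : Type*) : Type _ := proPCompletion p (FreeGroup V)

/-- The free generator of the free pro-`p` group corresponding to `v`. -/
def FreeProP.of (p : ℕ) {V : Type*} (v : V) : FreeProP p V :=
  toProPCompletion p (FreeGroup V) (FreeGroup.of v)

/-- The defining relators of the oriented pro-`p` RAAG of a digraph, where
`[x, y] = x y x⁻¹ y⁻¹`: `[v, w]` for every undirected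
edge (that is, `(v, w)` and `(w, v)` are both edges), and `[w, v] * v ^ (-q)` for every directed
edge `(v, w)` (that is, `(v, w)` is an edge and `(w, v)` is not). -/
def raagRelators {V : Type*} (Γ : Digraph V) (p q : ℕ) : Set (FreeProP p V) :=
  {r | ∃ v w : V,
    (Γ.Adj v w ∧ Γ.Adj w v ∧
      r = FreeProP.of p v * FreeProP.of p w * (FreeProP.of p v)⁻¹ * (FreeProP.of p w)⁻¹) ∨
    (Γ.Adj v w ∧ ¬ Γ.Adj w v ∧
      r = FreeProP.of p w * FreeProP.of p v * (FreeProP.of p w)⁻¹ * (FreeProP.of p v)⁻¹ *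
        (FreeProP.of p v ^ q)⁻¹)}

/-- The closed normal subgroup of the free pro-`p` group generated by the relators. -/
def raagRelations {V : Type*} (Γ : Digraph V) (p q : ℕ) : Subgroup (FreeProP p V) :=
  (Subgroup.normalClosure (raagRelators Γ p q)).topologicalClosure

instance {V : Type*} (Γ : Digraph V) (p q : ℕ) : (raagRelations Γ p q).Normal :=
  Subgroup.is_normal_topologicalClosure _

/-- The oriented pro-`p` RAAG associated to the digraph `Γ` and to `q` (a power of `p`), with the
quotient topology. -/
abbrev OrientedRAAG {V : Type*} (Γ : Digraph V) (p q : ℕ) : Type _ :=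
  FreeProP p V ⧸ raagRelations Γ p q

/-- The generator of the oriented pro-`p` RAAG corresponding to the vertex `v`. -/
def OrientedRAAG.of {V : Type*} (Γ : Digraph V) (p q : ℕ) (v : V) : OrientedRAAG Γ p q :=
  QuotientGroup.mk (FreeProP.of p v)

/-! ## Continuous cochains with coefficients in `𝔽_p` -/

section Cochains

variable (p : ℕ) (G : Type*) [Group G] [TopologicalSpace G] [IsTopologicalGroup G]

/-- The coboundary `C¹(G) → C²(G)`, `(d f)(g, h) = f h - f (g h) + f g` (trivial action). -/
def coboundaryOne : C(G, ZMod p) →ₗ[ZMod p] C(G × G, ZMod p) where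
  toFun f := ⟨fun x => f x.2 - f (x.1 * x.2) + f x.1, by fun_prop⟩
  map_add' f g := by ext x; simp; ring
  map_smul' c f := by ext x; simp; ring

/-- The coboundary `C²(G) → C³(G)`,
`(d f)(g, h, k) = f (h, k) - f (g h, k) + f (g, h k) - f (g, h)` (trivial action). -/
def coboundaryTwo : C(G × G, ZMod p) →ₗ[ZMod p] C(G × G × G, ZMod p) where
  toFun f := ⟨fun x => f (x.2.1, x.2.2) - f (x.1 * x.2.1, x.2.2) + f (x.1, x.2.1 * x.2.2)
    - f (x.1, x.2.1), by fun_prop⟩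
  map_add' f g := by ext x; simp; ring
  map_smul' c f := by ext x; simp; ring

/-- `H¹(G, 𝔽_p)`, the space of continuous homomorphisms `G → 𝔽_p`: for the trivial action these
are the continuous `1`-cocycles, and the only `1`-coboundary is `0`. -/
abbrev ContH1 : Type _ := LinearMap.ker (coboundaryOne p G)

/-- The space of continuous `2`-cocycles. -/
abbrev ContZ2 : Submodule (ZMod p) C(G × G, ZMod p) := LinearMap.ker (coboundaryTwo p G)

/-- The space of continuous `2`-coboundaries, as a subspace of the space of `2`-cocycles. -/
abbrev ContB2 : Submodule (ZMod p) (ContZ2 p G) :=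
  (LinearMap.range (coboundaryOne p G)).submoduleOf (ContZ2 p G)

/-- The continuous cohomology group `H²(G, 𝔽_p)`. -/
abbrev ContH2 : Type _ := ContZ2 p G ⧸ ContB2 p G

variable {p G}

/-- The cup product of two `1`-cochains: the `2`-cochain `(g, h) ↦ a g * b h`. -/
def cupOne (a b : C(G, ZMod p)) : C(G × G, ZMod p) :=
  ⟨fun x => a x.1 * b x.2, by fun_prop⟩

/-- `c = (c i j)`, for `0 ≤ i < j ≤ n` with `(i, j) ≠ (0, n)`, is a defining system for the `n`-fold
Massey product `⟨α 0, …, α (n - 1)⟩`: one has `c i (i + 1) = α i`, and `d (c i j)` is the sum of the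
cup products `c i l ∪ c l j` over `i < l < j`. (The other entries of `c` play no role.) -/
structure IsMasseyDefiningSystem {n : ℕ} (α : Fin n → ContH1 p G)
    (c : Fin (n + 1) → Fin (n + 1) → C(G, ZMod p)) : Prop where
  diag : ∀ i : Fin n, c i.castSucc i.succ = (α i).1
  coboundary : ∀ i j : Fin (n + 1), i < j → (i, j) ≠ (0, Fin.last n) →
    coboundaryOne p G (c i j) = ∑ l ∈ Finset.Ioo i j, cupOne (c i l) (c l j)

/-- The `n`-fold Massey product `⟨α 0, …, α (n - 1)⟩ ⊆ H²(G, 𝔽_p)`: the set of the classes of the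
`2`-cocycles `∑_{0 < l < n} c 0 l ∪ c l n`, for all defining systems `c`. -/
def masseyProduct {n : ℕ} (α : Fin n → ContH1 p G) : Set (ContH2 p G) :=
  {x | ∃ c : Fin (n + 1) → Fin (n + 1) → C(G, ZMod p), IsMasseyDefiningSystem α c ∧
    ∃ z : ContZ2 p G,
      z.1 = ∑ l ∈ Finset.Ioo 0 (Fin.last n), cupOne (c 0 l) (c l (Fin.last n)) ∧
      (ContB2 p G).mkQ z = x}

/-- A Massey product is essential if it is defined (nonempty) and does not vanish (does not contain
`0`). -/
def MasseyEssential {n : ℕ} (α : Fin n → ContH1 p G) : Prop :=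
  (masseyProduct α).Nonempty ∧ (0 : ContH2 p G) ∉ masseyProduct α

/-- The sequence `α, β, …, β, α` of length `n`, whose first and last terms are `α`. -/
def endsSequence {M : Type*} (n : ℕ) (α β : M) : Fin n → M :=
  fun i => if i.val = 0 ∨ i.val + 1 = n then α else β

end Cochains

/-! ## The dual basis of `H¹` of an oriented pro-`p` RAAG -/

section Dual

variable {V : Type*} {p : ℕ} [Fact p.Prime]

theorem isPGroup_multiplicative_zmod (p : ℕ) [Fact p.Prime] :
    IsPGroup p (Multiplicative (ZMod p)) :=
  IsPGroup.of_card (n := 1) (by simp [Nat.card_eq_fintype_card])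

open Classical in
/-- The continuous homomorphism from the free pro-`p` group to `𝔽_p` that maps the generator `u`
to `1` and all the other generators to `0`. -/
def freeVertexDual (p : ℕ) [Fact p.Prime] (u : V) : FreeProP p V →* Multiplicative (ZMod p) :=
  proPLift (isPGroup_multiplicative_zmod p)
    (FreeGroup.lift fun x => Multiplicative.ofAdd (if x = u then (1 : ZMod p) else 0))

theorem raagRelations_le_ker (Γ : Digraph V) {q : ℕ} (hq : p ∣ q) (u : V) :
    raagRelations Γ p q ≤ (freeVertexDual p u).ker := by
  have hc : Continuous (freeVertexDual p u) := continuous_proPLift _ _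
  refine Subgroup.topologicalClosure_minimal _ ?_ ?_
  · refine Subgroup.normalClosure_le_normal ?_
    rintro r ⟨v, w, ⟨-, -, rfl⟩ | ⟨-, -, rfl⟩⟩
    · simp [MonoidHom.mem_ker]
    · have h : ∀ y : Multiplicative (ZMod p), y ^ q = 1 := fun y => by
        obtain ⟨k, rfl⟩ := hq
        apply Multiplicative.toAdd.injective
        simp
      simp [MonoidHom.mem_ker, h]
  · exact isClosed_singleton.preimage hc

/-- The homomorphism of pro-`p` groups induced by `u^* : V → 𝔽_p` on the oriented pro-`p` RAAG. -/
def vertexDualHom (Γ : Digraph V) {q : ℕ} (hq : p ∣ q) (u : V) :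
    OrientedRAAG Γ p q →* Multiplicative (ZMod p) :=
  QuotientGroup.lift (raagRelations Γ p q) (freeVertexDual p u)
    (fun _ hx => raagRelations_le_ker Γ hq u hx)

theorem continuous_vertexDualHom (Γ : Digraph V) {q : ℕ} (hq : p ∣ q) (u : V) :
    Continuous (vertexDualHom Γ hq u) :=
  Continuous.quotient_lift (continuous_proPLift _ _) _

/-- The class `u^* ∈ H¹(G, 𝔽_p)` of a vertex `u`, for the oriented pro-`p` RAAG `G`: the continuous
homomorphism `G → 𝔽_p` that maps `u` to `1` and all the other vertices to `0`. -/
def vertexDual (Γ : Digraph V) {q : ℕ} (hq : p ∣ q) (u : V) : ContH1 p (OrientedRAAG Γ p q) :=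
  ⟨⟨fun x => Multiplicative.toAdd (vertexDualHom Γ hq u x),
    continuous_toAdd.comp (continuous_vertexDualHom Γ hq u)⟩, by
    ext x
    simp [coboundaryOne]⟩

open Classical in
theorem vertexDual_of (Γ : Digraph V) {q : ℕ} (hq : p ∣ q) (u v : V) :
    (vertexDual Γ hq u).1 (OrientedRAAG.of Γ p q v) = if v = u then 1 else 0 := by
  change Multiplicative.toAdd (FreeGroup.lift
    (fun x => Multiplicative.ofAdd (if x = u then (1 : ZMod p) else 0)) (FreeGroup.of v)) = _
  simp

end Dual

/-- The three distinct vertices `u`, `v`, `w` of the (loopless) digraph `Γ` span an induced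
subdigraph in which `(u, w)` is a directed edge, `u` and `v` are not joined, and either `(v, w)` is
a directed edge, or `(w, v)` is an edge (directed or not). -/
structure IsNonCliqueSpecialTriple {V : Type*} (Γ : Digraph V) (u v w : V) : Prop where
  ne_uv : u ≠ v
  ne_uw : u ≠ w
  ne_vw : v ≠ w
  adj_uw : Γ.Adj u w
  not_adj_wu : ¬ Γ.Adj w u
  not_adj_uv : ¬ Γ.Adj u v
  not_adj_vu : ¬ Γ.Adj v u
  vw : (Γ.Adj v w ∧ ¬ Γ.Adj w v) ∨ Γ.Adj w v

end

/-!
Dwyer's correspondence turns a defining system `c` into the map `g ↦ 1 - (c i j g)`, which is a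
homomorphism from `G` to the unitriangular matrices of size `q + 1` modulo the corner entry; the
product contains `0` exactly when such a homomorphism lifts to the unitriangular group itself.

Send `u` and `v` to `1 - N` and `1 - M`, with `N` and `M` supported on the superdiagonal, and the
other vertices to `1`. The `q`-th powers of unitriangular matrices lie in the corner, and `u` and
`v` are not adjacent, so all relations hold modulo the corner, and the product is non-empty.

In a lift, let `U`, `W` be the images of `u`, `w`. All superdiagonal entries of `1 - U` are `1`, so
`U ^ q` is a nontrivial corner matrix and the relation between `u` and `w` says that `W` and `U`
commute up to the corner but not exactly. The images of `v` and `w` have `q`-th power `1`, since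
`q ≥ 3` makes the superdiagonal of `v` vanish in the middle, so they commute. Comparing
superdiagonals, a unitriangular matrix that commutes with the image of `v`, and with `U` up to the
corner, commutes with `U`: a contradiction.
-/

noncomputable section

section Band

variable {R : Type*} [Ring R] {m k l : ℕ} {A B : Matrix (Fin m) (Fin m) R}

/-- The additive group of the `m × m` matrices that vanish strictly below the `k`-th superdiagonal:
upper triangular matrices for `k = 0`, strictly upper triangular ones for `k = 1`. -/
def upperBand (R : Type*) [Ring R] (m k : ℕ) : AddSubgroup (Matrix (Fin m) (Fin m) R) where
  carrier := {A | ∀ i j : Fin m, j.val < i.val + k → A i j = 0}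
  zero_mem' := fun _ _ _ => rfl
  add_mem' := fun hA hB i j h => by rw [Matrix.add_apply, hA i j h, hB i j h, add_zero]
  neg_mem' := fun hA i j h => by rw [Matrix.neg_apply, hA i j h, neg_zero]

theorem upperBand_antitone : Antitone (upperBand R m) :=
  fun _ _ hkl _ hA i j h => hA i j (by omega)

theorem eq_zero_of_mem_upperBand (hA : A ∈ upperBand R m k) (h : m ≤ k) : A = 0 := by
  ext i j
  exact hA i j (by omega)

theorem one_mem_upperBand_zero : (1 : Matrix (Fin m) (Fin m) R) ∈ upperBand R m 0 :=
  fun i j h => Matrix.one_apply_ne (by rintro rfl; omega)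

theorem mul_mem_upperBand (hA : A ∈ upperBand R m k) (hB : B ∈ upperBand R m l) :
    A * B ∈ upperBand R m (k + l) := by
  intro i j h
  rw [Matrix.mul_apply]
  refine Finset.sum_eq_zero fun s _ => ?_
  by_cases hs : s.val < i.val + k
  · rw [hA i s hs, zero_mul]
  · rw [hB s j (by omega), mul_zero]

theorem pow_mem_upperBand (hA : A ∈ upperBand R m k) (r : ℕ) : A ^ r ∈ upperBand R m (r * k) := by
  induction r with
  | zero => simpa using one_mem_upperBand_zero
  | succ r ih =>
    rw [pow_succ, Nat.succ_mul]
    exact mul_mem_upperBand ih hA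

theorem isNilpotent_of_mem_upperBand_one (hA : A ∈ upperBand R m 1) : IsNilpotent A :=
  ⟨m, eq_zero_of_mem_upperBand (pow_mem_upperBand hA m) (mul_one m).ge⟩

theorem mul_apply_of_mem_upperBand (hA : A ∈ upperBand R m k) (hB : B ∈ upperBand R m l)
    {i s j : Fin m} (his : s.val = i.val + k) (hsj : j.val = s.val + l) :
    (A * B) i j = A i s * B s j := by
  rw [Matrix.mul_apply]
  refine Finset.sum_eq_single s (fun t _ hts => ?_) (fun h => absurd (Finset.mem_univ s) h)
  have hts' : t.val ≠ s.val := fun h => hts (Fin.ext h)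
  by_cases h : t.val < i.val + k
  · rw [hA i t h, zero_mul]
  · rw [hB t j (by omega), mul_zero]

theorem mul_apply_eq_sum_Ioo (hA : A ∈ upperBand R m 1) (hB : B ∈ upperBand R m 1) (i j : Fin m) :
    (A * B) i j = ∑ l ∈ Finset.Ioo i j, A i l * B l j := by
  rw [Matrix.mul_apply]
  refine (Finset.sum_subset (Finset.subset_univ _) fun l _ hl => ?_).symm
  rw [Finset.mem_Ioo, not_and_or, Fin.lt_def, Fin.lt_def] at hl
  rcases hl with h | h
  · rw [hA i l (by omega), zero_mul]
  · rw [hB l j (by omega), mul_zero]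

theorem mem_upperBand_succ (hA : A ∈ upperBand R m k)
    (h : ∀ i j : Fin m, j.val = i.val + k → A i j = 0) : A ∈ upperBand R m (k + 1) :=
  fun i j hij => (Nat.lt_succ_iff_lt_or_eq.1 hij).elim (hA i j) (h i j)

theorem apply_eq_zero_of_mem_upperBand_last {n : ℕ} {A : Matrix (Fin (n + 1)) (Fin (n + 1)) R}
    (hA : A ∈ upperBand R (n + 1) n) {i j : Fin (n + 1)} (hij : (i, j) ≠ (0, Fin.last n)) :
    A i j = 0 := by
  refine hA i j (not_le.1 fun h => hij (Prod.ext (Fin.ext ?_) (Fin.ext ?_)))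
  · simp only [Fin.val_zero]
    omega
  · simp only [Fin.val_last]
    omega

theorem pow_apply_zero_last {R : Type*} [CommRing R] {n : ℕ}
    {A : Matrix (Fin (n + 1)) (Fin (n + 1)) R} (hA : A ∈ upperBand R (n + 1) 1) :
    (A ^ n) 0 (Fin.last n) = ∏ i : Fin n, A i.castSucc i.succ := by
  suffices h : ∀ r (hr : r ≤ n), (A ^ r) 0 ⟨r, by omega⟩ =
      ∏ i : Fin r, A (i.castLE hr).castSucc (i.castLE hr).succ from h n le_rfl
  intro r
  induction r with
  | zero => exact fun _ => by simp
  | succ r ih =>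
    intro hr
    rw [pow_succ, mul_apply_of_mem_upperBand (pow_mem_upperBand hA r) hA (s := ⟨r, by omega⟩)
      (by simp) rfl, ih (by omega), Fin.prod_univ_castSucc]
    rfl

theorem pow_eq_one_sub_one_sub_pow {m p f q : ℕ} [Fact p.Prime] [CharP R p] (hq : q = p ^ f)
    (A : Matrix (Fin m) (Fin m) R) : A ^ q = 1 - (1 - A) ^ q := by
  cases m with
  | zero => exact Subsingleton.elim _ _
  | succ m =>
    rw [hq, sub_pow_char_pow_of_commute _ _ (Commute.one_left A), one_pow, sub_sub_cancel]

end Band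

section Rigidity

variable {R : Type*} [Ring R] {n d : ℕ} {D M N : Matrix (Fin (n + 1)) (Fin (n + 1)) R}

theorem commutator_apply_of_mem_upperBand (hD : D ∈ upperBand R (n + 1) d)
    (hN : N ∈ upperBand R (n + 1) 1) {i j : Fin n} (hij : j.val = i.val + d) :
    (D * N - N * D) i.castSucc j.succ =
      D i.castSucc j.castSucc * N j.castSucc j.succ -
        N i.castSucc i.succ * D i.succ j.succ := by
  rw [Matrix.sub_apply,
    mul_apply_of_mem_upperBand hD hN (s := j.castSucc) (by simpa using hij) (by simp),
    mul_apply_of_mem_upperBand hN hD (s := i.succ) (by simp)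
      (by simp only [Fin.val_succ]; omega)]

theorem superdiagonal_const_of_commutator_mem (hD : D ∈ upperBand R (n + 1) d)
    (hN : N ∈ upperBand R (n + 1) 1) (hN1 : ∀ i : Fin n, N i.castSucc i.succ = 1)
    (hDN : D * N - N * D ∈ upperBand R (n + 1) n) {i j : Fin n} (hij : j.val = i.val + d)
    (hd : d + 1 < n) : D i.castSucc j.castSucc = D i.succ j.succ := by
  have h := commutator_apply_of_mem_upperBand hD hN hij
  rw [hDN _ _ (by simp only [Fin.val_succ, Fin.val_castSucc]; omega), hN1, hN1, mul_one, one_mul]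
    at h
  exact sub_eq_zero.1 h.symm

theorem mem_upperBand_succ_of_commutator_mem (hD : D ∈ upperBand R (n + 1) d)
    (hN : N ∈ upperBand R (n + 1) 1) (hM : M ∈ upperBand R (n + 1) 1)
    (hN1 : ∀ i : Fin n, N i.castSucc i.succ = 1)
    (hM1 : ∀ i : Fin n, M i.castSucc i.succ = endsSequence n 1 0 i)
    (hDN : D * N - N * D ∈ upperBand R (n + 1) n) (hDM : Commute D M)
    (hd : 1 ≤ d) (hdn : d + 1 < n) : D ∈ upperBand R (n + 1) (d + 1) := by
  have hconst : ∀ {i j : Fin n}, j.val = i.val + d → D i.castSucc j.castSucc = D i.succ j.succ :=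
    fun hij => superdiagonal_const_of_commutator_mem hD hN hN1 hDN hij hdn
  have hfirst : D (⟨0, by omega⟩ : Fin n).succ (⟨d, by omega⟩ : Fin n).succ = 0 := by
    have h := commutator_apply_of_mem_upperBand hD hM (i := ⟨0, by omega⟩) (j := ⟨d, by omega⟩)
      (by simp)
    rw [hDM.eq, sub_self, hM1, hM1, endsSequence, endsSequence, if_neg (by dsimp only; omega),
      if_pos (by simp), mul_zero, one_mul, zero_sub] at h
    exact neg_eq_zero.1 h.symm
  refine mem_upperBand_succ hD fun i => ?_
  induction i using Fin.induction with
  | zero =>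
    intro j hj
    rw [← hfirst, ← hconst (by simp)]
    congr 1
    exact Fin.ext (by simpa using hj)
  | succ i ih =>
    intro j hj
    obtain ⟨k, rfl⟩ := Fin.exists_succ_eq_of_ne_zero (x := j) (by
      rintro rfl
      rw [Fin.val_zero, Fin.val_succ] at hj
      omega)
    have hk : k.val = i.val + d := by
      simp only [Fin.val_succ] at hj
      omega
    rw [← hconst hk]
    exact ih k.castSucc (by simpa using hk)

/-- Comparing superdiagonals one at a time, a strictly upper triangular `D` that commutes with `M`,
and with `N` up to the corner, can only be nonzero in the last two superdiagonals; there the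
corners of `D * N - N * D` and of `D * M - M * D` agree. -/
theorem commute_of_commutator_mem_upperBand (hD : D ∈ upperBand R (n + 1) 1)
    (hN : N ∈ upperBand R (n + 1) 1) (hM : M ∈ upperBand R (n + 1) 1)
    (hN1 : ∀ i : Fin n, N i.castSucc i.succ = 1)
    (hM1 : ∀ i : Fin n, M i.castSucc i.succ = endsSequence n 1 0 i)
    (hDN : D * N - N * D ∈ upperBand R (n + 1) n) (hDM : Commute D M) : Commute D N := by
  have hDlast : ∀ d < n, D ∈ upperBand R (n + 1) d := fun d => by
    induction d with
    | zero => exact fun _ => upperBand_antitone zero_le_one hD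
    | succ d ih =>
      intro hdn
      rcases d.eq_zero_or_pos with rfl | hd
      · exact hD
      · exact mem_upperBand_succ_of_commutator_mem (ih (by omega)) hN hM hN1 hM1 hDN hDM hd hdn
  cases n with
  | zero =>
    rw [eq_zero_of_mem_upperBand hD le_rfl]
    exact Commute.zero_left N
  | succ m =>
    have hDm : D ∈ upperBand R (m + 1 + 1) m := hDlast m m.lt_succ_self
    have hcorner : (D * N - N * D) 0 (Fin.last (m + 1)) = (D * M - M * D) 0 (Fin.last (m + 1)) := by
      have h0 : ((Fin.last m : Fin (m + 1)) : ℕ) = (0 : Fin (m + 1)).val + m := by simp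
      rw [← Fin.succ_last, ← Fin.castSucc_zero, commutator_apply_of_mem_upperBand hDm hN h0,
        commutator_apply_of_mem_upperBand hDm hM h0, hN1, hN1, hM1, hM1]
      simp [endsSequence]
    refine sub_eq_zero.1 (Matrix.ext fun i j => ?_)
    by_cases hij : (i, j) = (0, Fin.last (m + 1))
    · obtain ⟨rfl, rfl⟩ := Prod.mk.inj hij
      rw [hcorner, hDM.eq, sub_self]
    · exact apply_eq_zero_of_mem_upperBand_last hDN hij

end Rigidity

section Relations

/-- The family `x` satisfies the relations defining the oriented right-angled Artin group of `Γ` and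
`q`, written without inverses so that they also make sense for matrices. -/
structure IsOrientedRAAGFamily {V M : Type*} [Monoid M] (Γ : Digraph V) (q : ℕ) (x : V → M) :
    Prop where
  commute : ∀ {v w : V}, Γ.Adj v w → Γ.Adj w v → Commute (x v) (x w)
  mul_eq : ∀ {v w : V}, Γ.Adj v w → ¬ Γ.Adj w v → x w * x v = x v ^ q * (x v * x w)

theorem IsOrientedRAAGFamily.map {V M N : Type*} [Monoid M] [Monoid N] {Γ : Digraph V} {q : ℕ}
    {x : V → M} (hx : IsOrientedRAAGFamily Γ q x) (φ : M →* N) :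
    IsOrientedRAAGFamily Γ q (fun v => φ (x v)) where
  commute hvw hwv := (hx.commute hvw hwv).map φ
  mul_eq hvw hwv := by simp only [← map_mul, ← map_pow, hx.mul_eq hvw hwv]

theorem forall_raagRelators_map_eq_one_iff {V P : Type*} [Group P] {Γ : Digraph V} {p q : ℕ}
    (φ : FreeProP p V →* P) : (∀ r ∈ raagRelators Γ p q, φ r = 1) ↔
      IsOrientedRAAGFamily Γ q (fun v => φ (FreeProP.of p v)) := by
  have commutator_eq_one (a b : P) : a * b * a⁻¹ * b⁻¹ = 1 ↔ Commute a b :=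
    commutatorElement_eq_one_iff_commute
  have commutator_eq_pow (a b : P) :
      b * a * b⁻¹ * a⁻¹ * (a ^ q)⁻¹ = 1 ↔ b * a = a ^ q * (a * b) := by
    rw [mul_inv_eq_one, mul_inv_eq_iff_eq_mul, mul_inv_eq_iff_eq_mul, mul_assoc]
  refine ⟨fun h => ⟨fun {v w} hvw hwv => ?_, fun {v w} hvw hwv => ?_⟩, fun h => ?_⟩
  · simpa only [map_mul, map_inv, commutator_eq_one] using h _ ⟨v, w, Or.inl ⟨hvw, hwv, rfl⟩⟩
  · simpa only [map_mul, map_inv, map_pow, commutator_eq_pow] using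
      h _ ⟨v, w, Or.inr ⟨hvw, hwv, rfl⟩⟩
  · rintro r ⟨v, w, ⟨hvw, hwv, rfl⟩ | ⟨hvw, hwv, rfl⟩⟩
    · simpa only [map_mul, map_inv, commutator_eq_one] using h.commute hvw hwv
    · simpa only [map_mul, map_inv, map_pow, commutator_eq_pow] using h.mul_eq hvw hwv

theorem OrientedRAAG.isOrientedRAAGFamily_of {V : Type*} (Γ : Digraph V) (p q : ℕ) :
    IsOrientedRAAGFamily Γ q (OrientedRAAG.of Γ p q) :=
  (forall_raagRelators_map_eq_one_iff (QuotientGroup.mk' (raagRelations Γ p q))).1 fun r hr =>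
    (QuotientGroup.eq_one_iff r).2
      (Subgroup.le_topologicalClosure _ (Subgroup.subset_normalClosure hr))

theorem OrientedRAAG.exists_continuous_hom {V P : Type*} [Group P] [Finite P] [TopologicalSpace P]
    [T1Space P] {Γ : Digraph V} {p q : ℕ} [Fact p.Prime] (hP : IsPGroup p P) {x : V → P}
    (hx : IsOrientedRAAGFamily Γ q x) :
    ∃ φ : OrientedRAAG Γ p q →* P, Continuous φ ∧ ∀ v, φ (OrientedRAAG.of Γ p q v) = x v := by
  have hc : Continuous (proPLift hP (FreeGroup.lift x)) := continuous_proPLift _ _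
  have hof : ∀ v, proPLift hP (FreeGroup.lift x) (FreeProP.of p v) = x v :=
    fun v => (proPLift_apply hP _ _).trans FreeGroup.lift_apply_of
  have hker : raagRelations Γ p q ≤ (proPLift hP (FreeGroup.lift x)).ker :=
    Subgroup.topologicalClosure_minimal _
      (Subgroup.normalClosure_le_normal ((forall_raagRelators_map_eq_one_iff _).2 (by
        simpa only [hof] using hx)))
      (isClosed_singleton.preimage hc)
  exact ⟨QuotientGroup.lift _ _ hker, Continuous.quotient_lift hc _, hof⟩

end Relations

section Obstruction

theorem mul_eq_self_of_mem_upperBand {R : Type*} [Ring R] {n : ℕ}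
    {A K : Matrix (Fin (n + 1)) (Fin (n + 1)) R} (hK : K ∈ upperBand R (n + 1) n)
    (hA : 1 - A ∈ upperBand R (n + 1) 1) : K * A = K := by
  have h := eq_zero_of_mem_upperBand (mul_mem_upperBand hK hA) le_rfl
  rwa [mul_sub, mul_one, sub_eq_zero, eq_comm] at h

variable {R : Type*} [CommRing R] {n p f : ℕ} {A B : Matrix (Fin (n + 1)) (Fin (n + 1)) R}

theorem pow_eq_zero_of_superdiagonal_eq_zero (hA : A ∈ upperBand R (n + 1) 1) {i : Fin n}
    (hi : A i.castSucc i.succ = 0) : A ^ n = 0 := by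
  ext j k
  by_cases hjk : (j, k) = (0, Fin.last n)
  · obtain ⟨rfl, rfl⟩ := Prod.mk.inj hjk
    rw [pow_apply_zero_last hA, Finset.prod_eq_zero (Finset.mem_univ i) hi, Matrix.zero_apply]
  · exact apply_eq_zero_of_mem_upperBand_last (by simpa using pow_mem_upperBand hA n) hjk

theorem pow_eq_one_of_superdiagonal_eq_zero [Fact p.Prime] [CharP R p] (hn : n = p ^ f)
    (hA : 1 - A ∈ upperBand R (n + 1) 1) {i : Fin n} (hi : (1 - A) i.castSucc i.succ = 0) :
    A ^ n = 1 := by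
  rw [pow_eq_one_sub_one_sub_pow hn A, pow_eq_zero_of_superdiagonal_eq_zero hA hi, sub_zero]

theorem commutator_one_sub_of_mul_eq_pow_mul [Fact p.Prime] [CharP R p] (hn : n = p ^ f)
    (hA : 1 - A ∈ upperBand R (n + 1) 1) (hB : 1 - B ∈ upperBand R (n + 1) 1)
    (h : B * A = A ^ n * (A * B)) :
    (1 - B) * (1 - A) - (1 - A) * (1 - B) = -(1 - A) ^ n := by
  have hK : (1 - A) ^ n ∈ upperBand R (n + 1) n := by simpa using pow_mem_upperBand hA n
  calc (1 - B) * (1 - A) - (1 - A) * (1 - B) = B * A - A * B := by noncomm_ring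
    _ = -((1 - A) ^ n * A * B) := by rw [h, pow_eq_one_sub_one_sub_pow hn A]; noncomm_ring
    _ = -(1 - A) ^ n := by
      rw [mul_eq_self_of_mem_upperBand hK hA, mul_eq_self_of_mem_upperBand hK hB]

theorem not_isOrientedRAAGFamily_of_superdiagonal {V : Type*} {Γ : Digraph V} {u v w : V}
    (huvw : IsNonCliqueSpecialTriple Γ u v w) [Fact p.Prime] [CharP R p] (hn : n = p ^ f)
    (hn3 : 3 ≤ n) {A : V → Matrix (Fin (n + 1)) (Fin (n + 1)) R}
    (hA : ∀ x, 1 - A x ∈ upperBand R (n + 1) 1)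
    (hu : ∀ i : Fin n, (1 - A u) i.castSucc i.succ = 1)
    (hv : ∀ i : Fin n, (1 - A v) i.castSucc i.succ = endsSequence n 1 0 i)
    (hw : ∀ i : Fin n, (1 - A w) i.castSucc i.succ = 0) :
    ¬ IsOrientedRAAGFamily Γ n A := by
  intro hrel
  have hwv : Commute (A w) (A v) := by
    have hv1 : A v ^ n = 1 := pow_eq_one_of_superdiagonal_eq_zero hn (hA v)
      (i := ⟨1, by omega⟩) ((hv _).trans (if_neg (by dsimp only; omega)))
    have hw1 : A w ^ n = 1 := pow_eq_one_of_superdiagonal_eq_zero hn (hA w)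
      (hw ⟨0, by omega⟩)
    rcases huvw.vw with ⟨hvw, hwv⟩ | hwv
    · exact (hrel.mul_eq hvw hwv).trans (by rw [hv1, one_mul])
    · by_cases hvw : Γ.Adj v w
      · exact hrel.commute hwv hvw
      · exact .symm ((hrel.mul_eq hwv hvw).trans (by rw [hw1, one_mul]))
  have hcomm := commutator_one_sub_of_mul_eq_pow_mul hn (hA u) (hA w)
    (hrel.mul_eq huvw.adj_uw huvw.not_adj_wu)
  have hwu : Commute (1 - A w) (1 - A u) :=
    commute_of_commutator_mem_upperBand (hA w) (hA u) (hA v) hu hv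
      (by simpa [hcomm] using pow_mem_upperBand (hA u) n)
      ((Commute.one_left _).sub_left ((Commute.one_right _).sub_right hwv))
  have hzero : (1 - A u) ^ n = 0 := by simpa [hwu.eq] using hcomm
  have hone : ((1 - A u) ^ n) 0 (Fin.last n) = 1 := by simp [pow_apply_zero_last (hA u), hu]
  have := CharP.nontrivial_of_char_ne_one (R := R) (Fact.out : p.Prime).ne_one
  exact zero_ne_one (by simpa only [hzero, Matrix.zero_apply] using hone)

end Obstruction

section Dwyer

variable {p : ℕ} {G : Type*} [TopologicalSpace G] {n : ℕ}

/-- The strictly upper triangular part of the matrix with entries `c i j g`. The entries of a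
defining system enter Dwyer's correspondence through `g ↦ 1 - strictMatrix c g`; the sign makes the
equations `d (c i j) = ∑ c i l ∪ c l j` say that this map is multiplicative. -/
def strictMatrix (c : Fin (n + 1) → Fin (n + 1) → C(G, ZMod p)) (g : G) :
    Matrix (Fin (n + 1)) (Fin (n + 1)) (ZMod p) :=
  fun i j => if i < j then c i j g else 0

theorem strictMatrix_apply_of_lt (c : Fin (n + 1) → Fin (n + 1) → C(G, ZMod p)) (g : G)
    {i j : Fin (n + 1)} (hij : i < j) : strictMatrix c g i j = c i j g :=
  if_pos hij

theorem strictMatrix_mem_upperBand (c : Fin (n + 1) → Fin (n + 1) → C(G, ZMod p)) (g : G) :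
    strictMatrix c g ∈ upperBand (ZMod p) (n + 1) 1 :=
  fun i j h => if_neg (by rw [Fin.lt_def]; omega)

theorem sum_cupOne_apply (c : Fin (n + 1) → Fin (n + 1) → C(G, ZMod p)) (i j : Fin (n + 1))
    (g h : G) : (∑ l ∈ Finset.Ioo i j, cupOne (c i l) (c l j)) (g, h) =
      (strictMatrix c g * strictMatrix c h) i j := by
  rw [mul_apply_eq_sum_Ioo (strictMatrix_mem_upperBand c g) (strictMatrix_mem_upperBand c h),
    ContinuousMap.sum_apply]
  refine Finset.sum_congr rfl fun l hl => ?_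
  obtain ⟨hil, hlj⟩ := Finset.mem_Ioo.1 hl
  rw [strictMatrix_apply_of_lt c g hil, strictMatrix_apply_of_lt c h hlj]
  rfl

variable [Group G]

/-- The amount by which `g ↦ 1 - strictMatrix c g` fails to be multiplicative at `(g, h)`. -/
def mulDefect (c : Fin (n + 1) → Fin (n + 1) → C(G, ZMod p)) (g h : G) :
    Matrix (Fin (n + 1)) (Fin (n + 1)) (ZMod p) :=
  (1 - strictMatrix c (g * h)) - (1 - strictMatrix c g) * (1 - strictMatrix c h)

theorem mulDefect_eq (c : Fin (n + 1) → Fin (n + 1) → C(G, ZMod p)) (g h : G) :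
    mulDefect c g h = strictMatrix c h - strictMatrix c (g * h) + strictMatrix c g -
      strictMatrix c g * strictMatrix c h := by
  rw [mulDefect]
  noncomm_ring

theorem mulDefect_mem_upperBand_one (c : Fin (n + 1) → Fin (n + 1) → C(G, ZMod p)) (g h : G) :
    mulDefect c g h ∈ upperBand (ZMod p) (n + 1) 1 := by
  have hc := strictMatrix_mem_upperBand c
  rw [mulDefect_eq]
  exact sub_mem (add_mem (sub_mem (hc h) (hc _)) (hc g))
    (upperBand_antitone one_le_two (mul_mem_upperBand (hc g) (hc h)))

variable [IsTopologicalGroup G]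

theorem coboundaryOne_eq_sum_cupOne_iff (c : Fin (n + 1) → Fin (n + 1) → C(G, ZMod p))
    {i j : Fin (n + 1)} (hij : i < j) :
    coboundaryOne p G (c i j) = ∑ l ∈ Finset.Ioo i j, cupOne (c i l) (c l j) ↔
      ∀ g h, mulDefect c g h i j = 0 := by
  simp only [ContinuousMap.ext_iff, Prod.forall, sum_cupOne_apply, mulDefect_eq, Matrix.sub_apply,
    Matrix.add_apply, strictMatrix_apply_of_lt c _ hij, sub_eq_zero]
  rfl

theorem mulDefect_eq_zero {c : Fin (n + 1) → Fin (n + 1) → C(G, ZMod p)}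
    (hc : ∀ i j, i < j →
      coboundaryOne p G (c i j) = ∑ l ∈ Finset.Ioo i j, cupOne (c i l) (c l j)) (g h : G) :
    mulDefect c g h = 0 := by
  ext i j
  rcases lt_or_ge i j with hlt | hle
  · exact (coboundaryOne_eq_sum_cupOne_iff c hlt).1 (hc i j hlt) g h
  · exact mulDefect_mem_upperBand_one c g h i j (Nat.lt_succ_of_le hle)

theorem isMasseyDefiningSystem_iff {α : Fin n → ContH1 p G}
    {c : Fin (n + 1) → Fin (n + 1) → C(G, ZMod p)} :
    IsMasseyDefiningSystem α c ↔ (∀ i : Fin n, c i.castSucc i.succ = (α i).1) ∧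
      ∀ g h, mulDefect c g h ∈ upperBand (ZMod p) (n + 1) n := by
  refine ⟨fun hc => ⟨hc.diag, fun g h i j hij => ?_⟩, fun hc => ⟨hc.1, fun i j hij hne => ?_⟩⟩
  · rcases lt_or_ge i j with hlt | hle
    · refine (coboundaryOne_eq_sum_cupOne_iff c hlt).1 (hc.coboundary i j hlt ?_) g h
      rintro ⟨rfl, rfl⟩
      simp at hij
    · exact mulDefect_mem_upperBand_one c g h i j (Nat.lt_succ_of_le hle)
  · exact (coboundaryOne_eq_sum_cupOne_iff c hij).2 fun g h =>
      apply_eq_zero_of_mem_upperBand_last (hc.2 g h) hne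

theorem superdiagonal_mem_ker_coboundaryOne (hn : 2 ≤ n)
    {c : Fin (n + 1) → Fin (n + 1) → C(G, ZMod p)}
    (hc : ∀ g h, mulDefect c g h ∈ upperBand (ZMod p) (n + 1) n) (i : Fin n) :
    c i.castSucc i.succ ∈ LinearMap.ker (coboundaryOne p G) := by
  rw [LinearMap.mem_ker, (coboundaryOne_eq_sum_cupOne_iff c i.castSucc_lt_succ).2
    fun g h => hc g h _ _ (by simp only [Fin.val_succ, Fin.val_castSucc]; omega)]
  refine Finset.sum_eq_zero fun l hl => absurd (Finset.mem_Ioo.1 hl) ?_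
  simp only [Fin.lt_def, Fin.val_castSucc, Fin.val_succ]
  omega

theorem IsMasseyDefiningSystem.sum_cupOne_mem_contZ2 {α : Fin n → ContH1 p G}
    {c : Fin (n + 1) → Fin (n + 1) → C(G, ZMod p)} (hc : IsMasseyDefiningSystem α c) :
    ∑ l ∈ Finset.Ioo 0 (Fin.last n), cupOne (c 0 l) (c l (Fin.last n)) ∈ ContZ2 p G := by
  have hX := strictMatrix_mem_upperBand c
  have hdefect := (isMasseyDefiningSystem_iff.1 hc).2
  have hleft : ∀ g h k, mulDefect c g h * strictMatrix c k = 0 := fun g h k =>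
    eq_zero_of_mem_upperBand (mul_mem_upperBand (hdefect g h) (hX k)) le_rfl
  have hright : ∀ g h k, strictMatrix c g * mulDefect c h k = 0 := fun g h k =>
    eq_zero_of_mem_upperBand (mul_mem_upperBand (hX g) (hdefect h k)) (add_comm 1 n).ge
  rw [LinearMap.mem_ker]
  ext ⟨g, h, k⟩
  set z := ∑ l ∈ Finset.Ioo 0 (Fin.last n), cupOne (c 0 l) (c l (Fin.last n))
  change z (h, k) - z (g * h, k) + z (g, h * k) - z (g, h) = 0
  simp only [z, sum_cupOne_apply, ← Matrix.sub_apply, ← Matrix.add_apply]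
  have hcocycle : strictMatrix c h * strictMatrix c k - strictMatrix c (g * h) * strictMatrix c k +
      strictMatrix c g * strictMatrix c (h * k) - strictMatrix c g * strictMatrix c h =
      mulDefect c g h * strictMatrix c k - strictMatrix c g * mulDefect c h k := by
    simp only [mulDefect_eq]
    noncomm_ring
  rw [hcocycle, hleft, hright, sub_zero, Matrix.zero_apply]

theorem masseyProduct_nonempty_iff {α : Fin n → ContH1 p G} :
    (masseyProduct α).Nonempty ↔ ∃ c, IsMasseyDefiningSystem α c :=
  ⟨fun ⟨_, c, hc, _⟩ => ⟨c, hc⟩,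
    fun ⟨c, hc⟩ => ⟨_, c, hc, ⟨_, hc.sum_cupOne_mem_contZ2⟩, rfl, rfl⟩⟩

theorem exists_coboundaryOne_eq_of_zero_mem_masseyProduct {α : Fin n → ContH1 p G} (hn : 2 ≤ n)
    (h : (0 : ContH2 p G) ∈ masseyProduct α) :
    ∃ c : Fin (n + 1) → Fin (n + 1) → C(G, ZMod p),
      (∀ i : Fin n, c i.castSucc i.succ = (α i).1) ∧
      ∀ i j, i < j →
        coboundaryOne p G (c i j) = ∑ l ∈ Finset.Ioo i j, cupOne (c i l) (c l j) := by
  classical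
  obtain ⟨c, hc, z, hz, hz0⟩ := h
  obtain ⟨b, hb⟩ : z.1 ∈ LinearMap.range (coboundaryOne p G) := by
    rwa [Submodule.mkQ_apply, Submodule.Quotient.mk_eq_zero] at hz0
  let c' : Fin (n + 1) → Fin (n + 1) → C(G, ZMod p) :=
    fun i j => if (i, j) = (0, Fin.last n) then b else c i j
  have hc' : ∀ {i j}, (i, j) ≠ (0, Fin.last n) → c' i j = c i j := fun h => if_neg h
  have hsum : ∀ i j, ∑ l ∈ Finset.Ioo i j, cupOne (c' i l) (c' l j) =
      ∑ l ∈ Finset.Ioo i j, cupOne (c i l) (c l j) := fun i j => by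
    refine Finset.sum_congr rfl fun l hl => ?_
    obtain ⟨hil, hlj⟩ := Finset.mem_Ioo.1 hl
    rw [hc' fun h => (hlj.trans_le (Fin.le_last j)).ne (Prod.mk.inj h).2,
      hc' fun h => ((Fin.zero_le i).trans_lt hil).ne' (Prod.mk.inj h).1]
  refine ⟨c', fun i => ?_, fun i j hij => ?_⟩
  · rw [hc', hc.diag i]
    simp only [ne_eq, Prod.mk.injEq, Fin.ext_iff, Fin.val_castSucc, Fin.val_succ, Fin.val_zero,
      Fin.val_last]
    omega
  · rw [hsum]
    by_cases hne : (i, j) = (0, Fin.last n)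
    · obtain ⟨rfl, rfl⟩ := Prod.mk.inj hne
      rw [← hz, ← hb]
      exact congrArg _ (if_pos rfl)
    · rw [hc' hne, hc.coboundary i j hij hne]

theorem exists_hom_of_zero_mem_masseyProduct {α : Fin n → ContH1 p G} (hn : 2 ≤ n)
    (h : (0 : ContH2 p G) ∈ masseyProduct α) :
    ∃ ρ : G →* Matrix (Fin (n + 1)) (Fin (n + 1)) (ZMod p),
      (∀ g, 1 - ρ g ∈ upperBand (ZMod p) (n + 1) 1) ∧
      ∀ (i : Fin n) (g : G), (1 - ρ g) i.castSucc i.succ = (α i).1 g := by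
  obtain ⟨c, hdiag, hc⟩ := exists_coboundaryOne_eq_of_zero_mem_masseyProduct hn h
  have hmul : ∀ g h, 1 - strictMatrix c (g * h) = (1 - strictMatrix c g) * (1 - strictMatrix c h) :=
    fun g h => sub_eq_zero.1 (mulDefect_eq_zero hc g h)
  have hone : strictMatrix c 1 = 0 := by
    have hidem : IsIdempotentElem (1 - strictMatrix c 1) := by
      rw [IsIdempotentElem, ← hmul, mul_one]
    exact (IsIdempotentElem.one_sub_iff.1 hidem).eq_zero_of_isNilpotent
      (isNilpotent_of_mem_upperBand_one (strictMatrix_mem_upperBand c 1))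
  refine ⟨⟨⟨fun g => 1 - strictMatrix c g, by rw [hone, sub_zero]⟩, hmul⟩, fun g => ?_,
    fun i g => ?_⟩
  · simpa using strictMatrix_mem_upperBand c g
  · simp [strictMatrix_apply_of_lt c g i.castSucc_lt_succ, hdiag]

end Dwyer

section Density

variable {p : ℕ} [Fact p.Prime] {H : Type*} [Group H]

theorem PIndexSubgroup.directed_ge :
    Directed (· ≥ ·) (PIndexSubgroup.toSubgroup : PIndexSubgroup p H → Subgroup H) := by
  intro N M
  have := N.normal
  have := M.normal
  obtain ⟨a, ha⟩ := N.index_eq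
  obtain ⟨b, hb⟩ := M.index_eq
  have hindex : (N.toSubgroup ⊓ M.toSubgroup).index ∣ p ^ (b + a) := by
    rw [pow_add, ← ha, ← hb, ← Subgroup.relIndex_mul_index inf_le_left, Subgroup.inf_relIndex_left]
    exact mul_dvd_mul_right (Subgroup.relIndex_dvd_index_of_normal _ _) _
  obtain ⟨k, -, hk⟩ := (Nat.dvd_prime_pow Fact.out).1 hindex
  exact ⟨⟨_, inferInstance, k, hk⟩, inf_le_left, inf_le_right⟩

instance PIndexSubgroup.instNonempty : Nonempty (PIndexSubgroup p H) :=
  ⟨⟨⊤, inferInstance, 0, by simp⟩⟩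

theorem denseRange_toProPCompletion : DenseRange (toProPCompletion p H) := by
  intro x
  rw [mem_closure_iff_nhds, nhds_subtype_eq_comap]
  intro U hU
  obtain ⟨W, hW, hWU⟩ := Filter.mem_comap.1 hU
  rw [nhds_pi, Filter.mem_pi] at hW
  obtain ⟨I, hI, t, ht, hIt⟩ := hW
  obtain ⟨M, hM⟩ := PIndexSubgroup.directed_ge.finset_le hI.toFinset
  have := M.normal
  obtain ⟨h, hh⟩ := QuotientGroup.mk'_surjective M.toSubgroup (x.1 M)
  refine ⟨toProPCompletion p H h, hWU (hIt fun N hN => ?_), h, rfl⟩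
  have hMN := hM N (hI.mem_toFinset.2 hN)
  have hxN : PQuotient.proj N h = x.1 N :=
    (congrArg (PQuotient.trans M N hMN) hh).trans (x.2 M N hMN)
  exact Set.mem_of_eq_of_mem hxN (mem_of_mem_nhds (ht N))

theorem OrientedRAAG.denseRange_lift_of {V : Type*} (Γ : Digraph V) (q : ℕ) :
    DenseRange (FreeGroup.lift (OrientedRAAG.of Γ p q)) := by
  have hlift : ⇑(FreeGroup.lift (OrientedRAAG.of Γ p q)) =
      QuotientGroup.mk' (raagRelations Γ p q) ∘ toProPCompletion p (FreeGroup V) :=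
    congrArg DFunLike.coe (FreeGroup.ext_hom _
      ((QuotientGroup.mk' (raagRelations Γ p q)).comp (toProPCompletion p (FreeGroup V)))
      fun v => FreeGroup.lift_apply_of)
  rw [hlift]
  exact (QuotientGroup.mk'_surjective _).denseRange.comp denseRange_toProPCompletion
    continuous_quotient_mk'

/-- A class in `H¹`, as a homomorphism into the multiplicative version of `𝔽_p`. -/
def contH1Hom {G : Type*} [Group G] [TopologicalSpace G] [IsTopologicalGroup G] (a : ContH1 p G) :
    G →* Multiplicative (ZMod p) :=
  MonoidHom.mk' (fun g => Multiplicative.ofAdd (a.1 g)) fun g h => by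
    have hgh : a.1 h - a.1 (g * h) + a.1 g = 0 :=
      DFunLike.congr_fun (LinearMap.mem_ker.1 a.2) (g, h)
    rw [← ofAdd_add]
    exact congrArg _ (by linear_combination -hgh)

theorem OrientedRAAG.contH1_ext {V : Type*} {Γ : Digraph V} {q : ℕ}
    {a b : ContH1 p (OrientedRAAG Γ p q)}
    (h : ∀ v, a.1 (OrientedRAAG.of Γ p q v) = b.1 (OrientedRAAG.of Γ p q v)) : a = b := by
  have hfree : (contH1Hom a).comp (FreeGroup.lift (OrientedRAAG.of Γ p q)) =
      (contH1Hom b).comp (FreeGroup.lift (OrientedRAAG.of Γ p q)) :=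
    FreeGroup.ext_hom _ _ fun v => by
      simp only [MonoidHom.comp_apply, FreeGroup.lift_apply_of]
      exact congrArg Multiplicative.ofAdd (h v)
  exact Subtype.ext (DFunLike.coe_injective
    ((denseRange_lift_of Γ q).equalizer a.1.continuous b.1.continuous
      (congrArg DFunLike.coe hfree)))

end Density

section Unitriangular

variable {R : Type*} [CommRing R] {m k : ℕ}

theorem inv_mem_upperBand_zero {g : (Matrix (Fin m) (Fin m) R)ˣ}
    (hg : g.1 ∈ upperBand R m 0) : g⁻¹.1 ∈ upperBand R m 0 := by
  rw [Matrix.coe_units_inv]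
  exact Matrix.blockTriangular_inv_of_blockTriangular (b := id) hg

theorem mem_upperBand_zero_of_one_sub_mem {A : Matrix (Fin m) (Fin m) R}
    (hA : 1 - A ∈ upperBand R m k) : A ∈ upperBand R m 0 := by
  simpa using sub_mem one_mem_upperBand_zero (upperBand_antitone k.zero_le hA)

/-- The group of the invertible upper triangular `m × m` matrices that agree with the identity
below the `k`-th superdiagonal: the full upper triangular group for `k = 0`, the unitriangular one
for `k = 1`. -/
def unitriangular (R : Type*) [CommRing R] (m k : ℕ) : Subgroup (Matrix (Fin m) (Fin m) R)ˣ where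
  carrier := {g | 1 - g.1 ∈ upperBand R m k}
  one_mem' := by simp
  mul_mem' {g h} hg hh := by
    have hgh := mul_mem_upperBand (mem_upperBand_zero_of_one_sub_mem hg) hh
    rw [zero_add] at hgh
    convert add_mem hg hgh using 1
    simp [mul_sub]
  inv_mem' {g} hg := by
    have hinv := neg_mem (mul_mem_upperBand
      (inv_mem_upperBand_zero (mem_upperBand_zero_of_one_sub_mem hg)) hg)
    rw [zero_add] at hinv
    convert hinv using 1
    simp [mul_sub]

theorem mem_unitriangular {g : (Matrix (Fin m) (Fin m) R)ˣ} :
    g ∈ unitriangular R m k ↔ 1 - g.1 ∈ upperBand R m k := Iff.rfl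

theorem conj_mem_unitriangular {g h : (Matrix (Fin m) (Fin m) R)ˣ} (hg : g ∈ unitriangular R m 0)
    (hh : h ∈ unitriangular R m k) : g * h * g⁻¹ ∈ unitriangular R m k := by
  have hg0 := mem_upperBand_zero_of_one_sub_mem hg
  have hconj := mul_mem_upperBand (mul_mem_upperBand hg0 hh) (inv_mem_upperBand_zero hg0)
  rw [zero_add, add_zero] at hconj
  simpa [mem_unitriangular, mul_sub, sub_mul] using hconj

theorem unitriangular_antitone : Antitone (unitriangular R m) :=
  fun _ _ h _ hg => upperBand_antitone h hg

theorem inv_mul_mem_unitriangular_iff {g h : (Matrix (Fin m) (Fin m) R)ˣ}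
    (hg : g ∈ unitriangular R m 0) :
    g⁻¹ * h ∈ unitriangular R m k ↔ g.1 - h.1 ∈ upperBand R m k := by
  have hg0 := mem_upperBand_zero_of_one_sub_mem hg
  refine ⟨fun h => ?_, fun h => ?_⟩
  · simpa [mul_sub] using mul_mem_upperBand hg0 h
  · simpa [mem_unitriangular, mul_sub] using mul_mem_upperBand (inv_mem_upperBand_zero hg0) h

theorem pow_mem_unitriangular {p f q : ℕ} [Fact p.Prime] [CharP R p] (hq : q = p ^ f)
    {g : (Matrix (Fin m) (Fin m) R)ˣ} (hg : g ∈ unitriangular R m 1) :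
    g ^ q ∈ unitriangular R m q := by
  have hpow := pow_mem_upperBand hg q
  rw [mul_one] at hpow
  rwa [mem_unitriangular, Units.val_pow_eq_pow_val, pow_eq_one_sub_one_sub_pow hq, sub_sub_cancel]

theorem isPGroup_unitriangular_one (p : ℕ) [Fact p.Prime] [CharP R p] :
    IsPGroup p (unitriangular R m 1) := fun g => by
  refine ⟨m, Subtype.ext (Units.ext (sub_eq_zero.1 ?_).symm)⟩
  exact eq_zero_of_mem_upperBand (pow_mem_unitriangular rfl g.2)
    (Nat.lt_pow_self (Fact.out : p.Prime).one_lt).le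

theorem exists_unitriangular_of_mem_upperBand {N : Matrix (Fin m) (Fin m) R}
    (hN : N ∈ upperBand R m 1) : ∃ g : unitriangular R m 1, g.1.1 = 1 - N := by
  obtain ⟨g, hg⟩ := (isNilpotent_of_mem_upperBand_one hN).isUnit_one_sub
  exact ⟨⟨g, by rwa [mem_unitriangular, hg, sub_sub_cancel]⟩, hg⟩

/-- The quotient of the group of unitriangular matrices of size `n + 1` by its subgroup of the
matrices that differ from the identity at most in the corner entry. -/
abbrev UnitriangularModCorner (R : Type*) [CommRing R] (n : ℕ) : Type _ :=
  unitriangular R (n + 1) 1 ⧸ (unitriangular R (n + 1) n).subgroupOf (unitriangular R (n + 1) 1)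

instance (n : ℕ) :
    ((unitriangular R (n + 1) n).subgroupOf (unitriangular R (n + 1) 1)).Normal where
  conj_mem _ hh g := conj_mem_unitriangular (unitriangular_antitone zero_le_one g.2) hh

theorem unitriangularModCorner_mk_eq_iff {n : ℕ} {g h : unitriangular R (n + 1) 1} :
    (g : UnitriangularModCorner R n) = h ↔ g.1.1 - h.1.1 ∈ upperBand R (n + 1) n := by
  rw [QuotientGroup.eq, Subgroup.mem_subgroupOf]
  exact inv_mul_mem_unitriangular_iff (unitriangular_antitone zero_le_one g.2)

end Unitriangular

section Existence

/-- The converse half of Dwyer's correspondence: a representation modulo the corner provides a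
defining system, through an arbitrary set-theoretic lift to the unitriangular group. -/
theorem exists_nonempty_masseyProduct_of_hom {p : ℕ} [Fact p.Prime] {G : Type*} [Group G]
    [TopologicalSpace G] [IsTopologicalGroup G] {n : ℕ} (hn : 2 ≤ n)
    {φ : G →* UnitriangularModCorner (ZMod p) n} (hφ : Continuous φ) :
    ∃ α : Fin n → ContH1 p G, (masseyProduct α).Nonempty ∧
      ∀ (g : G) (a : unitriangular (ZMod p) (n + 1) 1), φ g = a →
        ∀ i : Fin n, (α i).1 g = (1 - a.1.1) i.castSucc i.succ := by
  let c : Fin (n + 1) → Fin (n + 1) → C(G, ZMod p) := fun i j =>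
    ⟨fun g => (1 - (φ g).out.1.1) i j,
      (continuous_of_discreteTopology (f := fun x : UnitriangularModCorner (ZMod p) n =>
        (1 - x.out.1.1) i j)).comp hφ⟩
  have hout : ∀ g (a : unitriangular (ZMod p) (n + 1) 1), φ g = a →
      (φ g).out.1.1 - a.1.1 ∈ upperBand (ZMod p) (n + 1) n := fun g a h =>
    unitriangularModCorner_mk_eq_iff.1 ((QuotientGroup.out_eq' _).trans h)
  have hc : ∀ g, strictMatrix c g = 1 - (φ g).out.1.1 := fun g => Matrix.ext fun i j => by
    rcases lt_or_ge i j with hlt | hle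
    · exact strictMatrix_apply_of_lt c g hlt
    · exact (if_neg hle.not_gt).trans ((φ g).out.2 i j (Nat.lt_succ_of_le hle)).symm
  have hdefect : ∀ g h, mulDefect c g h ∈ upperBand (ZMod p) (n + 1) n := fun g h => by
    simpa only [mulDefect, hc, sub_sub_cancel, Subgroup.coe_mul, Units.val_mul] using
      hout (g * h) ((φ g).out * (φ h).out) (by
        rw [map_mul, QuotientGroup.mk_mul, QuotientGroup.out_eq', QuotientGroup.out_eq'])
  refine ⟨fun i => ⟨_, superdiagonal_mem_ker_coboundaryOne hn hdefect i⟩,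
    masseyProduct_nonempty_iff.2 ⟨c, isMasseyDefiningSystem_iff.2 ⟨fun _ => rfl, hdefect⟩⟩,
    fun g a h i => ?_⟩
  have hlift := hout g a h i.castSucc i.succ
    (by simp only [Fin.val_succ, Fin.val_castSucc]; omega)
  rw [Matrix.sub_apply, sub_eq_zero] at hlift
  simp [c, hlift]

/-- The matrix of size `n + 1` with superdiagonal entries `a 0, …, a (n - 1)` and zeros elsewhere,
the standard choice of a unipotent `1 - superdiagonal a` with prescribed superdiagonal. -/
def superdiagonal {R : Type*} [Zero R] {n : ℕ} (a : Fin n → R) :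
    Matrix (Fin (n + 1)) (Fin (n + 1)) R :=
  fun i j => if h : i.val < n ∧ j.val = i.val + 1 then a ⟨i, h.1⟩ else 0

theorem superdiagonal_castSucc_succ {R : Type*} [Zero R] {n : ℕ} (a : Fin n → R) (i : Fin n) :
    superdiagonal a i.castSucc i.succ = a i := by
  simp [superdiagonal]

theorem superdiagonal_mem_upperBand {R : Type*} [Ring R] {n : ℕ} (a : Fin n → R) :
    superdiagonal a ∈ upperBand R (n + 1) 1 :=
  fun i j h => dif_neg (by omega)

theorem masseyProduct_nonempty_of_commute {V : Type*} {Γ : Digraph V} {p f q n : ℕ}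
    [Fact p.Prime] (hq : q = p ^ f) (hn : 2 ≤ n) (hnq : n ≤ q)
    {α : Fin n → ContH1 p (OrientedRAAG Γ p q)}
    (hα : ∀ x y, Γ.Adj x y →
      Commute (superdiagonal fun i => (α i).1 (OrientedRAAG.of Γ p q x))
        (superdiagonal fun i => (α i).1 (OrientedRAAG.of Γ p q y))) :
    (masseyProduct α).Nonempty := by
  choose A hA using fun x => exists_unitriangular_of_mem_upperBand
    (superdiagonal_mem_upperBand fun i => (α i).1 (OrientedRAAG.of Γ p q x))
  have hcomm : ∀ {x y}, Γ.Adj x y → Commute (A x) (A y) := fun {x y} hxy => by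
    refine Subtype.ext (Units.ext ?_)
    change (A x).1.1 * (A y).1.1 = (A y).1.1 * (A x).1.1
    rw [hA, hA]
    exact (Commute.one_left _).sub_left ((Commute.one_right _).sub_right (hα x y hxy))
  have hpow : ∀ x, (A x : UnitriangularModCorner (ZMod p) n) ^ q = 1 := fun x =>
    (QuotientGroup.eq_one_iff _).2 (unitriangular_antitone hnq (pow_mem_unitriangular hq (A x).2))
  have hrel : IsOrientedRAAGFamily Γ q fun x => (A x : UnitriangularModCorner (ZMod p) n) :=
    { commute := fun hxy _ => (hcomm hxy).map (QuotientGroup.mk' _)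
      mul_eq := fun hxy _ => by
        rw [hpow, one_mul]
        exact ((hcomm hxy).map (QuotientGroup.mk' _)).symm }
  obtain ⟨φ, hφ, hφA⟩ := OrientedRAAG.exists_continuous_hom
    ((isPGroup_unitriangular_one p).to_quotient _) hrel
  obtain ⟨β, hβ, hβφ⟩ := exists_nonempty_masseyProduct_of_hom hn hφ
  have hβα : β = α := funext fun i => OrientedRAAG.contH1_ext fun x => by
    rw [hβφ _ _ (hφA x), hA, sub_sub_cancel, superdiagonal_castSucc_succ]
  exact hβα ▸ hβ

end Existence

section Triple

theorem endsSequence_contH1_apply {p n : ℕ} {G : Type*} [Group G] [TopologicalSpace G]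
    [IsTopologicalGroup G] (a b : ContH1 p G) (i : Fin n) (g : G) :
    (endsSequence n a b i).1 g = endsSequence n (a.1 g) (b.1 g) i := by
  rw [endsSequence, endsSequence]
  split_ifs <;> rfl

variable {V : Type*} {Γ : Digraph V} {p q n : ℕ} [Fact p.Prime] {u v : V}

open Classical in
theorem endsSequence_vertexDual_of (hq : p ∣ q) (u v x : V) (i : Fin n) :
    (endsSequence n (vertexDual Γ hq u + vertexDual Γ hq v) (vertexDual Γ hq u) i).1
      (OrientedRAAG.of Γ p q x) =
      endsSequence n ((if x = u then 1 else 0) + if x = v then 1 else 0)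
        (if x = u then (1 : ZMod p) else 0) i := by
  rw [endsSequence_contH1_apply]
  exact congrArg₂ (fun a b => endsSequence n a b i)
    (congrArg₂ _ (vertexDual_of Γ hq u x) (vertexDual_of Γ hq v x)) (vertexDual_of Γ hq u x)

theorem masseyProduct_endsSequence_nonempty {f : ℕ} (hpq : p ∣ q) (hq : q = p ^ f) (hq2 : 2 ≤ q)
    (huv : ¬ Γ.Adj u v) (hvu : ¬ Γ.Adj v u) :
    (masseyProduct (endsSequence q (vertexDual Γ hpq u + vertexDual Γ hpq v)
      (vertexDual Γ hpq u))).Nonempty := by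
  refine masseyProduct_nonempty_of_commute hq hq2 le_rfl fun x y hxy => ?_
  have hzero : ∀ x, x ≠ u → x ≠ v → (superdiagonal fun i => (endsSequence q
      (vertexDual Γ hpq u + vertexDual Γ hpq v) (vertexDual Γ hpq u) i).1
        (OrientedRAAG.of Γ p q x)) = 0 := fun x hu hv => by
    simp only [endsSequence_vertexDual_of, if_neg hu, if_neg hv]
    ext i j
    simp [superdiagonal, endsSequence]
  by_cases hx : x = u ∨ x = v
  · by_cases hy : y = u ∨ y = v
    · obtain rfl : x = y := by grind
      exact Commute.refl _
    · rw [hzero y (by tauto) (by tauto)]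
      exact Commute.zero_right _
  · rw [hzero x (by tauto) (by tauto)]
    exact Commute.zero_left _

theorem zero_notMem_masseyProduct_endsSequence {f : ℕ} {w : V} (hpq : p ∣ q) (hq : q = p ^ f)
    (hq3 : 3 ≤ q) (huvw : IsNonCliqueSpecialTriple Γ u v w) :
    0 ∉ masseyProduct (endsSequence q (vertexDual Γ hpq u + vertexDual Γ hpq v)
      (vertexDual Γ hpq u)) := by
  intro h0
  obtain ⟨ρ, hρ, hρα⟩ := exists_hom_of_zero_mem_masseyProduct (by omega) h0
  refine not_isOrientedRAAGFamily_of_superdiagonal huvw hq hq3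
    (fun x => hρ (OrientedRAAG.of Γ p q x)) (fun i => ?_) (fun i => ?_) (fun i => ?_)
    ((OrientedRAAG.isOrientedRAAGFamily_of Γ p q).map ρ) <;>
  rw [hρα, endsSequence_vertexDual_of]
  · simp [huvw.ne_uv, endsSequence]
  · simp [huvw.ne_uv.symm]
  · simp [huvw.ne_uw.symm, huvw.ne_vw.symm, endsSequence]

end Triple

theorem three_le_prime_pow {p f : ℕ} (hp : p.Prime) (hf : f ≠ 0) (hf2 : p = 2 → 2 ≤ f) :
    3 ≤ p ^ f := by
  rcases hp.two_le.eq_or_lt with h2 | h3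
  · subst h2
    exact (by norm_num : 3 ≤ 2 ^ 2).trans (Nat.pow_le_pow_right two_pos (hf2 rfl))
  · exact (Nat.succ_le_of_lt h3).trans (Nat.le_self_pow hf p)

theorem proposition6p1_general {V : Type*} (Γ : Digraph V)
    (p f : ℕ) [Fact p.Prime] (hf : f ≠ 0) (hf2 : p = 2 → 2 ≤ f)
    (u v w : V) (huvw : IsNonCliqueSpecialTriple Γ u v w) :
    MasseyEssential (endsSequence (p ^ f)
      (vertexDual Γ (dvd_pow_self p hf) u + vertexDual Γ (dvd_pow_self p hf) v)
      (vertexDual Γ (dvd_pow_self p hf) u)) := by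
  have hq : 3 ≤ p ^ f := three_le_prime_pow Fact.out hf hf2
  exact ⟨masseyProduct_endsSequence_nonempty _ rfl (by omega) huvw.not_adj_uv huvw.not_adj_vu,
    zero_notMem_masseyProduct_endsSequence _ rfl hq huvw⟩

end

theorem proposition6p1 {V : Type*} [Finite V] (Γ : Digraph V) (hΓ : ∀ x, ¬ Γ.Adj x x)
    (p f : ℕ) [Fact p.Prime] (hf : f ≠ 0) (hf2 : p = 2 → 2 ≤ f)
    (u v w : V) (huvw : IsNonCliqueSpecialTriple Γ u v w) :
    MasseyEssential (endsSequence (p ^ f)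
      (vertexDual Γ (dvd_pow_self p hf) u + vertexDual Γ (dvd_pow_self p hf) v)
      (vertexDual Γ (dvd_pow_self p hf) u)) :=
  proposition6p1_general Γ p f hf hf2 u v w huvw
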